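/- **Machines.** A *two counter machine with input* (TCMI) over a finite alphabet $A$ is a deterministic program with finitely many lines (states), an initial line, and two counters holding natural numbers, initially $0$. Each line carries one of the instructions: increment a counter and go to a line; decrement a counter and go to a line (impossible if the counter is $0$); go to one of two lines according to whether a counter is $0$; go to a line; read the next input symbol and go to a line depending on it; halt. On a word $w$ over $A$ the machine is run on the input $w\diamond$, where $\diamond\notin A$ is a stop marker. Its output on $w$ is a fixed function of the state in which it halts after having consumed the whole input $w\diamond$. The machine works *online* if the counters never change after $\diamond$ has been read. **Best approximation.** Let $d\ge 2$, $n\ge 1$, and let $x>0$ be rational. The best $n$-digit approximation of $x$ in radix $d$ is the number $m\,d^k$, with integers $m,k$ and $d^{n-1}\le m<d^n$, that is closest to $x$; a tie is resolved in favour of the even significand $m$ (and in favour of the larger number if both significands are odd, which is possible only for $n=1$ and $d$ even). The integer $m$ is its significand. **Proposition.** Let $d,D,b\ge 2$ be radices and let $n\ge 1$. Numbers are input as arbitrary strings of radix-$b$ digits (superfluous zeros are allowed, and the empty string has value $0$). (1) For each choice of the digit order (least or most significant digit first) for $f$ and for $|e|$, there is a TCMI that works online and that, for all integers $f>0$ and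 $e$, outputs the significand of the best $n$-digit radix-$d$ approximation of $f\times D^e$ when its input consists of the digits of $f$, a separator, a minus sign if $e$ is negative (a minus sign is also allowed if $e=0$), and the digits of $|e|$, followed by $\diamond$. (2) For each integer $f>0$, each sign $\sigma\in\{1,-1\}$ and each digit order there is a TCMI with input alphabet $\{0,1,\dots,b-1\}$, together with the stop marker $\diamond$, that works online and that, for every integer $a\ge 0$, outputs the significand of the best $n$-digit radix-$d$ approximation of $f\times D^{\sigma a}$ when the digits of $a$, followed by $\diamond$, are input. -/

import Mathlib

/-- Instructions of a two counter machine with input symbols in `A` (plus a stop marker) and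
lines (states) in `Q`; the counters are indexed by `Fin 2`. In `read`, the value `none` of type
`Option A` is the stop marker. A line carrying a `read` instruction is a wait state. -/
inductive TCMI.Instr (A Q : Type) : Type
  | inc (i : Fin 2) (q : Q)
  | dec (i : Fin 2) (q : Q)
  | ifZero (i : Fin 2) (q q' : Q)
  | goto (q : Q)
  | read (next : Option A → Q)
  | halt

/-- A (deterministic) two counter machine with input. -/
structure TCMI (A Q : Type) : Type where
  start : Q
  code : Q → TCMI.Instr A Q

namespace TCMI

variable {A Q : Type}

/-- A configuration: the current state, the two counters, the input not yet consumed. -/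
structure Cfg (A Q : Type) : Type where
  state : Q
  counter : Fin 2 → ℕ
  input : List (Option A)

/-- One move. There is no move from a halting line, from a wait state when no input is left, or
from a decrement of an empty counter. -/
def step (M : TCMI A Q) (c : Cfg A Q) : Option (Cfg A Q) :=
  match M.code c.state with
  | .inc i q => some ⟨q, Function.update c.counter i (c.counter i + 1), c.input⟩
  | .dec i q =>
      if c.counter i = 0 then none
      else some ⟨q, Function.update c.counter i (c.counter i - 1), c.input⟩
  | .ifZero i q q' => some ⟨if c.counter i = 0 then q else q', c.counter, c.input⟩
  | .goto q => some ⟨q, c.counter, c.input⟩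
  | .read next =>
      match c.input with
      | [] => none
      | a :: rest => some ⟨next a, c.counter, rest⟩
  | .halt => none

/-- `c'` is reached from `c` in finitely many (possibly zero) moves. -/
def Reaches (M : TCMI A Q) : Cfg A Q → Cfg A Q → Prop :=
  Relation.ReflTransGen fun c c' => M.step c = some c'

/-- The initial configuration on the word `w`: empty counters, and the input `w` followed by the
stop marker. -/
def init (M : TCMI A Q) (w : List A) : Cfg A Q :=
  ⟨M.start, fun _ => 0, w.map some ++ [none]⟩

/-- On the word `w` (followed by the stop marker) the machine consumes all of its input and
halts in the state `q`. -/
def HaltsIn (M : TCMI A Q) (w : List A) (q : Q) : Prop :=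
  M.code q = .halt ∧ ∃ k : Fin 2 → ℕ, M.Reaches (M.init w) ⟨q, k, []⟩

/-- The machine processes its input online: once the stop marker has been read in a wait state,
the counters never change. -/
def IsOnline (M : TCMI A Q) : Prop :=
  ∀ (q : Q) (next : Option A → Q), M.code q = .read next →
    ∀ (k : Fin 2 → ℕ) (c : Cfg A Q), M.Reaches ⟨next none, k, []⟩ c → c.counter = k

end TCMI

/-- `m * d ^ k` is the best `n`-digit approximation of `x` in radix `d`: `m` has exactly `n`
digits in radix `d`, and every other `n`-digit floating point number is farther from `x`, or
equally far and loses the tie. A tie goes to the even significand; if both significands are odd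
(which needs `n = 1` and `d` even) it goes to the larger number. -/
def IsBestApprox (d n : ℕ) (x : ℚ) (m : ℕ) (k : ℤ) : Prop :=
  d ^ (n - 1) ≤ m ∧ m < d ^ n ∧
    ∀ (m' : ℕ) (k' : ℤ), d ^ (n - 1) ≤ m' → m' < d ^ n → (m', k') ≠ (m, k) →
      |x - m * (d : ℚ) ^ k| < |x - m' * (d : ℚ) ^ k'| ∨
      (|x - m * (d : ℚ) ^ k| = |x - m' * (d : ℚ) ^ k'| ∧
        (Even m ∨ (Odd m' ∧ m' * (d : ℚ) ^ k' < m * (d : ℚ) ^ k)))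

/-- `m` is the significand of the best `n`-digit approximation of `x` in radix `d`. -/
def IsSignificand (d n : ℕ) (x : ℚ) (m : ℕ) : Prop :=
  ∃ k : ℤ, IsBestApprox d n x m k

/-- The order in which the digits of a number are presented. -/
inductive DigitOrder : Type
  | leastFirst
  | mostFirst

/-- The value of a string of radix `b` digits. Any string is allowed, in particular one with
superfluous zeros. -/
def DigitOrder.value {b : ℕ} : DigitOrder → List (Fin b) → ℕ
  | .leastFirst, z => Nat.ofDigits b (z.map Fin.val)
  | .mostFirst, z => Nat.ofDigits b (z.map Fin.val).reverse

/-- The integer with absolute value `a`, negative (or zero) if `neg` is true. -/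
def signed (neg : Bool) (a : ℕ) : ℤ :=
  if neg then -(a : ℤ) else a

/-- Symbols for the input of a floating point numeral: radix `b` digits, a separator between the
integer factor and the exponent, and a minus sign for the exponent. -/
inductive NumeralSymbol (b : ℕ) : Type
  | digit (a : Fin b)
  | sep
  | minus

/-- The word "digits `u` of the factor, separator, minus sign if the exponent is negative,
digits `v` of the absolute value of the exponent". -/
def numeral {b : ℕ} (u : List (Fin b)) (neg : Bool) (v : List (Fin b)) :
    List (NumeralSymbol b) :=
  u.map .digit ++ [.sep] ++ (if neg then [.minus] else []) ++ v.map .digit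

/-! Speed is irrelevant, so the claim splits into two independent facts.

Every primitive recursive transducer with boundedly many output values is simulated online
(`exists_online_of_primrec`). The first counter holds a product of prime powers whose exponents
serve as registers, and the second is scratch space. Loops over registers then evaluate all
primitive recursive functions (`regComputable_of_primrec`). The transducer's state is kept as a code
in register 0. After each symbol the machine already computes the output due if the input ended
there, and stores it in the wait line, so the stop marker costs no further counter operation.

The significand is a primitive recursive function of numerator and denominator
(`primrec_significand`), and bounded by `d ^ n`. Multiplying by a power of `d` does not change it,
so the integral part `m` of the quotient may be assumed to have `n` digits. No floating point number
lies strictly between `m` and `m + 1`, hence comparison with `m + 1/2` decides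
(`isSignificand_roundQuotient`). Reading digits in either order is a primitive recursive fold. -/

namespace TCMI

variable {A Q Q' : Type}

/-! ### Code with several exits and its composition -/

/-- Rename the target lines of an instruction. -/
def Instr.map (φ : Q → Q') : Instr A Q → Instr A Q'
  | .inc i q => .inc i (φ q)
  | .dec i q => .dec i (φ q)
  | .ifZero i q q' => .ifZero i (φ q) (φ q')
  | .goto q => .goto (φ q)
  | .read next => .read fun a => φ (next a)
  | .halt => .halt

theorem Instr.map_ne_read {φ : Q → Q'} {I : Instr A Q} (h : ∀ next, I ≠ .read next)
    (next : Option A → Q') : I.map φ ≠ .read next := by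
  cases I with
  | read f => exact absurd rfl (h f)
  | _ => simp [Instr.map]

/-- Rename the state of a configuration. -/
def Cfg.map (φ : Q → Q') (c : Cfg A Q) : Cfg A Q' :=
  ⟨φ c.state, c.counter, c.input⟩

theorem step_map {M : TCMI A Q} {M' : TCMI A Q'} (φ : Q → Q')
    (h : ∀ q, M.code q ≠ .halt → M'.code (φ q) = (M.code q).map φ) {c c' : Cfg A Q}
    (hc : M.step c = some c') : M'.step (c.map φ) = some (c'.map φ) := by
  obtain ⟨q, k, l⟩ := c
  have hq : M.code q ≠ .halt := by
    intro h0
    simp [step, h0] at hc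
  have h1 := h q hq
  unfold step at hc ⊢
  simp only [Cfg.map, h1]
  cases hM : M.code q with
  | inc i p =>
    simp only [hM, Option.some.injEq] at hc
    subst hc; rfl
  | dec i p =>
    simp only [hM] at hc
    split_ifs at hc with h0
    simp only [Option.some.injEq] at hc
    subst hc
    exact if_neg h0
  | ifZero i p p' =>
    simp only [hM, Option.some.injEq] at hc
    subst hc
    simp only [Instr.map, apply_ite φ]
    rfl
  | goto p =>
    simp only [hM, Option.some.injEq] at hc
    subst hc; rfl
  | read next =>
    cases l with
    | nil => simp [hM] at hc
    | cons a l =>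
      simp only [hM, Option.some.injEq] at hc
      subst hc; rfl
  | halt => exact absurd hM hq

/-- A machine that contains a copy of the code of another one simulates it. -/
theorem Reaches.map {M : TCMI A Q} {M' : TCMI A Q'} (φ : Q → Q')
    (h : ∀ q, M.code q ≠ .halt → M'.code (φ q) = (M.code q).map φ) {c c' : Cfg A Q}
    (hc : M.Reaches c c') : M'.Reaches (c.map φ) (c'.map φ) :=
  Relation.ReflTransGen.lift (Cfg.map φ) (fun _ _ hs => step_map φ h hs) _ _ hc

/-- The machine given by a piece of code with lines in `S` and exits in `E`; it halts at the
exits. -/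
def fragment {S E : Type} (start : S) (code : S → Instr A (S ⊕ E)) : TCMI A (S ⊕ E) :=
  ⟨.inl start, Sum.elim code fun _ => .halt⟩

/-- Some piece of code with exits in `E` that does not touch the input realizes the relation `R`
between data `x`, exits `e`, and data `y`, where data are represented by the counters through
`rep`. -/
def Computes (A : Type) {X E : Type} (rep : (Fin 2 → ℕ) → X → Prop) (R : X → E → X → Prop) :
    Prop :=
  ∃ (S : Type) (_ : Finite S) (start : S) (code : S → Instr A (S ⊕ E)),
    (∀ s next, code s ≠ .read next) ∧ ∀ x e y, R x e y → ∀ k, rep k x → ∃ k', rep k' y ∧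
      ∀ l, (fragment start code).Reaches ⟨.inl start, k, l⟩ ⟨.inr e, k', l⟩

namespace Computes

variable {X E E' : Type} {rep : (Fin 2 → ℕ) → X → Prop} {R R' : X → E → X → Prop}

/-- `R` is an obligation: each of its triples must be realized, and nothing is promised elsewhere. A
smaller relation therefore asks for less, and preconditions can be built into `R`. -/
theorem mono (h : Computes A rep R) (hR : ∀ x e y, R' x e y → R x e y) :
    Computes A rep R' := by
  obtain ⟨S, hS, s, code, hr, H⟩ := h
  exact ⟨S, hS, s, code, hr, fun x e y hxy => H x e y (hR x e y hxy)⟩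

/-- Change of the representation. -/
theorem lift {Y : Type} {rep' : (Fin 2 → ℕ) → Y → Prop} {T : Y → E → Y → Prop}
    (h : Computes A rep R)
    (hT : ∀ x e y, T x e y → ∀ k, rep' k x →
      ∃ x', rep k x' ∧ ∃ y', R x' e y' ∧ ∀ k', rep k' y' → rep' k' y) :
    Computes A rep' T := by
  obtain ⟨S, hS, s, code, hr, H⟩ := h
  refine ⟨S, hS, s, code, hr, fun x e y hxy k hk => ?_⟩
  obtain ⟨x', hx', y', hR, hy⟩ := hT x e y hxy k hk
  obtain ⟨k', hk', h'⟩ := H x' e y' hR k hx'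
  exact ⟨k', hy k' hk', h'⟩

theorem pure (e₀ : E) : Computes A rep fun x e y => e = e₀ ∧ y = x := by
  refine ⟨Unit, inferInstance, (), fun _ => .goto (.inr e₀), by simp, ?_⟩
  rintro x e y ⟨rfl, rfl⟩ k hk
  exact ⟨k, hk, fun l => .single rfl⟩

theorem bind [Finite E] {T : E → X → E' → X → Prop} (hR : Computes A rep R)
    (hT : ∀ e, Computes A rep (T e)) :
    Computes A rep fun x e' z => ∃ e y, R x e y ∧ T e y e' z := by
  obtain ⟨S, hS, s, code, hr, H⟩ := hR
  choose S' hS' s' code' hr' H' using hT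
  -- Exit `e` of the first piece is glued to the starting line of the continuation chosen for `e`.
  let φ : S ⊕ E → (S ⊕ Σ e, S' e) ⊕ E' :=
    Sum.elim (fun t => .inl (.inl t)) fun e => .inl (.inr ⟨e, s' e⟩)
  let ψ (e : E) : S' e ⊕ E' → (S ⊕ Σ e, S' e) ⊕ E' :=
    Sum.map (fun t => .inr ⟨e, t⟩) id
  let code'' : (S ⊕ Σ e, S' e) → Instr A ((S ⊕ Σ e, S' e) ⊕ E') :=
    Sum.elim (fun t => (code t).map φ) fun t => (code' t.1 t.2).map (ψ t.1)
  refine ⟨S ⊕ Σ e, S' e, inferInstance, .inl s, code'', ?_, ?_⟩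
  · rintro (t | t)
    · exact Instr.map_ne_read (hr t)
    · exact Instr.map_ne_read (hr' t.1 t.2)
  rintro x e' z ⟨e, y, hxy, hyz⟩ k hk
  obtain ⟨k₁, hk₁, h₁⟩ := H x e y hxy k hk
  obtain ⟨k₂, hk₂, h₂⟩ := H' e y e' z hyz k₁ hk₁
  refine ⟨k₂, hk₂, fun l => ?_⟩
  have g₁ := (h₁ l).map (M' := fragment (Sum.inl s) code'') φ (by
    rintro (t | t) ht
    · rfl
    · exact absurd rfl ht)
  have g₂ := (h₂ l).map (M' := fragment (Sum.inl s) code'') (ψ e) (by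
    rintro (t | t) ht
    · rfl
    · exact absurd rfl ht)
  exact g₁.trans g₂

end Computes

/-- Repeat `R` as long as the exit `none` is taken. -/
inductive Iter {X E : Type} (R : X → Option E → X → Prop) : X → E → X → Prop
  | done {x e y} : R x (some e) y → Iter R x e y
  | next {x y e z} : R x none y → Iter R y e z → Iter R x e z

namespace Computes

variable {X E E' : Type} {rep : (Fin 2 → ℕ) → X → Prop}

theorem iter {R : X → Option E → X → Prop} (hR : Computes A rep R) :
    Computes A rep (Iter R) := by
  obtain ⟨S, hS, s, code, hr, H⟩ := hR
  -- The exit `none` leads back to the starting line; termination is contained in the inductive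
  -- definition of `Iter`.
  let φ : S ⊕ Option E → S ⊕ E :=
    Sum.elim .inl fun e => e.elim (.inl s) .inr
  refine ⟨S, hS, s, fun t => (code t).map φ, fun t => Instr.map_ne_read (hr t), ?_⟩
  have key : ∀ {c c' : Cfg A (S ⊕ Option E)}, (fragment s code).Reaches c c' →
      (fragment s fun t => (code t).map φ).Reaches (c.map φ) (c'.map φ) := fun h =>
    h.map φ (by
      rintro (t | t) ht
      · rfl
      · exact absurd rfl ht)
  intro x e y hxy
  induction hxy with
  | done h =>
    intro k hk
    obtain ⟨k', hk', h'⟩ := H _ _ _ h k hk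
    exact ⟨k', hk', fun l => key (h' l)⟩
  | next h _ ih =>
    intro k hk
    obtain ⟨k', hk', h'⟩ := H _ _ _ h k hk
    obtain ⟨k'', hk'', h''⟩ := ih k' hk'
    exact ⟨k'', hk'', fun l => (key (h' l)).trans (h'' l)⟩

/-- Branch on a Boolean exit. -/
theorem cond {R : X → Bool → X → Prop} {T T' : X → E → X → Prop} (hR : Computes A rep R)
    (hT : Computes A rep T) (hT' : Computes A rep T') :
    Computes A rep fun x e z => ∃ y, (R x true y ∧ T y e z) ∨ (R x false y ∧ T' y e z) := by
  refine (hR.bind (T := fun b => if b then T else T') (by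
    rintro (_ | _)
    · exact hT'
    · exact hT)).mono ?_
  rintro x e z ⟨y, h | h⟩
  · exact ⟨true, y, h⟩
  · exact ⟨false, y, h⟩

end Computes

/-- Some piece of code transforms data `x` with the property `P` into `F x`. -/
def Performs (A : Type) {X : Type} (rep : (Fin 2 → ℕ) → X → Prop) (P : X → Prop) (F : X → X) :
    Prop :=
  Computes A rep fun x (_ : Unit) y => P x ∧ y = F x

namespace Performs

variable {X : Type} {rep : (Fin 2 → ℕ) → X → Prop} {P P' : X → Prop} {F G : X → X}

theorem congr (h : Performs A rep P F) (hP : ∀ x, P' x → P x) (hF : ∀ x, P' x → G x = F x) :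
    Performs A rep P' G :=
  Computes.mono h fun x _ _ hx => ⟨hP x hx.1, hx.2.trans (hF x hx.1)⟩

theorem id : Performs A rep P id :=
  (Computes.pure ()).mono fun _ _ _ h => ⟨rfl, h.2⟩

theorem seq (hF : Performs A rep P F) (hG : Performs A rep P' G) (h : ∀ x, P x → P' (F x)) :
    Performs A rep P fun x => G (F x) :=
  (Computes.bind hF fun _ => hG).mono fun x _ _ hx => ⟨(), F x, ⟨hx.1, rfl⟩, h x hx.1, hx.2⟩

/-- Performing `F` and then computing `R`. -/
theorem andThen {E : Type} {R : X → E → X → Prop} (hF : Performs A rep P F)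
    (hR : Computes A rep R) : Computes A rep fun x e y => P x ∧ R (F x) e y :=
  (Computes.bind hF fun _ => hR).mono fun x _ _ hx => ⟨(), F x, ⟨hx.1, rfl⟩, hx.2⟩

/-- Leaving through a given exit after performing `F`. -/
theorem exit {E : Type} (hF : Performs A rep P F) (e₀ : E) :
    Computes A rep fun x e y => P x ∧ e = e₀ ∧ y = F x :=
  hF.andThen (Computes.pure e₀)

end Performs

/-! ### Routines on the two counters -/

theorem performs_inc (i : Fin 2) :
    Performs A Eq (fun _ => True) fun k => Function.update k i (k i + 1) := by
  refine ⟨Unit, inferInstance, (), fun _ => .inc i (.inr ()), by simp, ?_⟩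
  rintro k e k' ⟨-, rfl⟩ _ rfl
  exact ⟨_, rfl, fun l => .single rfl⟩

/-- Decrement a counter unless it is empty; the exit tells whether this was possible. -/
theorem computes_dec (i : Fin 2) :
    Computes A Eq fun k (e : Bool) k' =>
      (k i = 0 ∧ e = false ∧ k' = k) ∨
        (k i ≠ 0 ∧ e = true ∧ k' = Function.update k i (k i - 1)) := by
  let code : Bool → Instr A (Bool ⊕ Bool) := fun t =>
    if t then .dec i (.inr true) else .ifZero i (.inr false) (.inl true)
  refine ⟨Bool, inferInstance, false, code, by simp [code], ?_⟩
  rintro k e k' (⟨h, rfl, rfl⟩ | ⟨h, rfl, rfl⟩) k₀ rfl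
  · refine ⟨_, rfl, fun l => .single ?_⟩
    simp [step, fragment, code, h]
  · refine ⟨_, rfl, fun l => .tail (b := ⟨.inl true, k₀, l⟩) (.single ?_) ?_⟩
    · simp [step, fragment, code, h]
    · simp [step, fragment, code, h]

theorem performs_add (i : Fin 2) (n : ℕ) :
    Performs A Eq (fun _ => True) fun k => Function.update k i (k i + n) := by
  induction n with
  | zero => exact Performs.id.congr (fun _ h => h) (by simp)
  | succ n ih =>
    refine (ih.seq (performs_inc i) fun _ h => h).congr (fun _ h => h) fun k _ => ?_
    simp [add_assoc]

/-- Subtract `n` from a counter if possible; the exit tells whether it was. -/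
theorem computes_sub (i : Fin 2) (n : ℕ) :
    Computes A Eq fun k (e : Bool) k' =>
      (k i < n ∧ e = false ∧ k' = k) ∨
        (n ≤ k i ∧ e = true ∧ k' = Function.update k i (k i - n)) := by
  induction n with
  | zero =>
    refine (Computes.pure true).mono ?_
    rintro k e k' (h | ⟨-, h, h'⟩)
    · omega
    · exact ⟨h, by simpa using h'⟩
  | succ n ih =>
    -- If the remaining `n` cannot be subtracted, the unit already taken is put back, so that
    -- failure leaves the counter as it was.
    refine ((computes_dec i).cond (ih.cond (Computes.pure true)
      ((performs_inc i).exit false)) (Computes.pure false)).mono ?_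
    rintro k e k' (⟨h, rfl, rfl⟩ | ⟨h, rfl, rfl⟩)
    · by_cases h0 : k' i = 0
      · exact ⟨k', .inr ⟨.inl ⟨h0, rfl, rfl⟩, rfl, rfl⟩⟩
      · refine ⟨_, .inl ⟨.inr ⟨h0, rfl, rfl⟩, _, .inr ⟨.inl ⟨?_, rfl, rfl⟩, trivial, rfl, ?_⟩⟩⟩
        · simp; omega
        · have : k' i - 1 + 1 = k' i := by omega
          simp [this]
    · refine ⟨_, .inl ⟨.inr ⟨by omega, rfl, rfl⟩, _, .inl ⟨.inr ⟨?_, rfl, rfl⟩, rfl, ?_⟩⟩⟩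
      · simp; omega
      · have : k i - 1 - n = k i - (n + 1) := by omega
        simp [this]

/-- Empty the counter `i`, adding `p` times its content to the counter `j`. -/
theorem performs_moveMul {i j : Fin 2} (hij : i ≠ j) (p : ℕ) :
    Performs A Eq (fun _ => True) fun k =>
      Function.update (Function.update k j (k j + p * k i)) i 0 := by
  refine (((computes_dec i).cond ((performs_add j p).exit none)
    (Computes.pure (some ()))).iter).mono ?_
  rintro k ⟨⟩ k' ⟨-, rfl⟩
  induction h : k i generalizing k with
  | zero =>
    refine .done ⟨_, .inr ⟨.inl ⟨h, rfl, rfl⟩, rfl, ?_⟩⟩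
    ext t
    by_cases ht : t = i <;> by_cases ht' : t = j <;> simp_all
  | succ n ih =>
    refine .next ⟨_, .inl ⟨.inr ⟨by omega, rfl, rfl⟩, trivial, rfl, rfl⟩⟩ ?_
    -- One round does not alter the predicted result, since `p + p * n = p * (n + 1)`.
    convert ih _ _ using 1
    · ext t
      by_cases ht : t = i
      · simp [ht]
      · by_cases ht' : t = j
        · subst ht'
          simp [hij, ht, h]; ring
        · simp [ht, ht']
    · simp [hij, h]

/-- Divide the first counter by `p` with the help of the second one. -/
theorem performs_divMod {p : ℕ} (hp : 0 < p) :
    Performs A Eq (fun _ => True) fun k => ![k 0 % p, k 1 + k 0 / p] := by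
  refine (((computes_sub 0 p).cond ((performs_inc 1).exit none)
    (Computes.pure (some ()))).iter).mono ?_
  rintro k ⟨⟩ k' ⟨-, rfl⟩
  induction h : k 0 using Nat.strong_induction_on generalizing k with
  | _ n ih =>
    subst h
    by_cases hk : k 0 < p
    · refine .done ⟨_, .inr ⟨.inl ⟨hk, rfl, rfl⟩, rfl, ?_⟩⟩
      ext t
      fin_cases t <;> simp [Nat.mod_eq_of_lt hk, Nat.div_eq_of_lt hk]
    · push Not at hk
      have h1 := Nat.mod_eq_sub_mod hk
      have h2 := Nat.div_eq_sub_div hp hk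
      refine .next ⟨_, .inl ⟨.inr ⟨hk, rfl, rfl⟩, trivial, rfl, rfl⟩⟩ ?_
      convert ih (k 0 - p) (by omega) (Function.update (Function.update k 0 (k 0 - p)) 1 (k 1 + 1))
        (by simp) using 1
      · ext t
        fin_cases t <;> simp
      · ext t
        fin_cases t
        · simpa using h1
        · simp [h2]; ring

/-! ### Registers -/

/-- The registers `r` are represented by the exponents in the prime factorization of the first
counter; the second counter is empty. -/
def RegRep (k : Fin 2 → ℕ) (r : ℕ → ℕ) : Prop :=
  k 1 = 0 ∧ k 0 ≠ 0 ∧ ∀ i, (k 0).factorization (Nat.nth Nat.Prime i) = r i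

/-- Incrementing an exponent means multiplying by its prime, which happens while the content moves
to the second counter; it is then moved back unchanged. -/
theorem performs_regInc (i : ℕ) :
    Performs A RegRep (fun _ => True) fun r => Function.update r i (r i + 1) := by
  refine Computes.lift (((performs_moveMul (i := 0) (j := 1) (by decide)
    (Nat.nth Nat.Prime i)).seq (performs_moveMul (i := 1) (j := 0) (by decide) 1)) fun _ h => h) ?_
  rintro r ⟨⟩ _ ⟨-, rfl⟩ k ⟨h1, h0, hf⟩
  have hp := Nat.prime_nth_prime i
  refine ⟨k, rfl, _, ⟨trivial, rfl⟩, ?_⟩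
  rintro _ rfl
  refine ⟨by simp, by simp [h1, h0, hp.ne_zero], fun j => ?_⟩
  simp only [h1, Function.update_self, ne_eq, zero_ne_one, not_false_eq_true,
    Function.update_of_ne, one_ne_zero, zero_add, one_mul]
  rw [Nat.factorization_mul hp.ne_zero h0, hp.factorization]
  by_cases hj : j = i
  · subst hj
    simp [hf, add_comm]
  · have : Nat.nth Nat.Prime i ≠ Nat.nth Nat.Prime j := fun h =>
      hj (Nat.nth_injective Nat.infinite_setOfPred_prime h).symm
    simp [hf, hj, this]

theorem computes_regDec (i : ℕ) :
    Computes A RegRep fun r (e : Bool) r' =>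
      (r i = 0 ∧ e = false ∧ r' = r) ∨
        (r i ≠ 0 ∧ e = true ∧ r' = Function.update r i (r i - 1)) := by
  have hp := Nat.prime_nth_prime i
  set p := Nat.nth Nat.Prime i with hpi
  -- A nonzero remainder means that the exponent is `0`: the decrement that tested it is undone and
  -- the number is reassembled as remainder plus `p` times quotient. Otherwise the quotient is the
  -- new content.
  refine Computes.lift ((performs_divMod hp.pos).andThen ((computes_dec 0).cond
    (((performs_inc 0).seq (performs_moveMul (i := 1) (j := 0) (by decide) p)
      fun _ h => h).exit false)
    ((performs_moveMul (i := 1) (j := 0) (by decide) 1).exit true))) ?_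
  rintro r e r' H k ⟨h1, h0, hf⟩
  have hdvd : p ∣ k 0 ↔ r i ≠ 0 := by
    rw [← hf i, ← hpi, hp.dvd_iff_one_le_factorization h0]
    omega
  refine ⟨k, rfl, ?_⟩
  rcases H with ⟨h, rfl, rfl⟩ | ⟨h, rfl, rfl⟩
  · have hm : k 0 % p ≠ 0 := fun hm => hdvd.1 (Nat.dvd_of_mod_eq_zero hm) h
    refine ⟨_, ⟨trivial, _, .inl ⟨.inr ⟨by simpa using hm, rfl, rfl⟩, trivial, rfl, rfl⟩⟩, ?_⟩
    rintro _ rfl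
    have hk : k 0 % p - 1 + 1 + p * (k 0 / p) = k 0 := by
      rw [Nat.sub_add_cancel (by omega), Nat.mod_add_div]
    refine ⟨by simp, ?_, fun j => ?_⟩
    · simpa [h1, hk] using h0
    · simpa [h1, hk] using hf j
  · have hd := hdvd.2 h
    have hm : k 0 % p = 0 := Nat.mod_eq_zero_of_dvd hd
    refine ⟨_, ⟨trivial, _, .inr ⟨.inl ⟨by simpa using hm, rfl, rfl⟩, trivial, rfl, rfl⟩⟩, ?_⟩
    rintro _ rfl
    refine ⟨by simp, ?_, fun j => ?_⟩
    · simp only [h1, hm, ne_eq]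
      simpa [hp.ne_zero] using Nat.le_of_dvd (Nat.pos_of_ne_zero h0) hd
    · simp only [h1, hm]
      simp only [Matrix.cons_val_zero, Matrix.cons_val_one, zero_add, one_mul, ne_eq,
        zero_ne_one, not_false_eq_true, Function.update_of_ne, Function.update_self,
        Matrix.cons_val_fin_one]
      rw [Nat.factorization_div hd, hp.factorization]
      by_cases hj : j = i
      · subst hj
        simp [← hf, hpi]
      · have : p ≠ Nat.nth Nat.Prime j := fun h =>
          hj (Nat.nth_injective Nat.infinite_setOfPred_prime h).symm
        simp [hf, hj, this]

end TCMI

/-! ### Primitive recursive functions on registers -/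

namespace TCMI

variable {A : Type}

open Function

/-- A loop that decrements the register `i` before each round. -/
theorem performs_loop (i : ℕ) {P I : (ℕ → ℕ) → Prop} {F T : (ℕ → ℕ) → ℕ → ℕ}
    (hF : Performs A RegRep P F) (h0 : ∀ r, I r → r i = 0 → T r = r)
    (hs : ∀ r, I r → r i ≠ 0 → P (update r i (r i - 1)) ∧ I (F (update r i (r i - 1))) ∧
      F (update r i (r i - 1)) i = r i - 1 ∧ T (F (update r i (r i - 1))) = T r) :
    Performs A RegRep I T := by
  refine (((computes_regDec i).cond (hF.exit none) (Computes.pure (some ()))).iter).mono ?_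
  rintro r ⟨⟩ _ ⟨hI, rfl⟩
  induction h : r i generalizing r with
  | zero => exact .done ⟨_, .inr ⟨.inl ⟨h, rfl, rfl⟩, rfl, h0 r hI h⟩⟩
  | succ n ih =>
    have hr : r i ≠ 0 := by omega
    obtain ⟨hP, hI', hi, hT⟩ := hs r hI hr
    refine .next ⟨_, .inl ⟨.inr ⟨hr, rfl, rfl⟩, hP, rfl, rfl⟩⟩ ?_
    -- `T` is constant along the rounds and is the identity at the end, so it describes the whole
    -- loop.
    rw [← hT]
    exact ih _ hI' (by omega)

theorem performs_clear (i : ℕ) :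
    Performs A RegRep (fun _ => True) fun r => update r i 0 := by
  refine performs_loop i (Performs.id (P := fun _ => True)) (fun r _ h => ?_) fun r _ h => ?_
  · simp [← h]
  · simp

theorem performs_move {i j : ℕ} (hij : i ≠ j) :
    Performs A RegRep (fun _ => True) fun r => update (update r j (r j + r i)) i 0 := by
  refine performs_loop i (performs_regInc j) (fun r _ h => ?_) fun r _ h => ?_
  · rw [h, add_zero, update_eq_self, ← h, update_eq_self]
  · refine ⟨trivial, trivial, by simp [hij], ?_⟩
    ext t
    simp only [update_apply]
    grind

/-- Reading a register destroys it, so its content goes to `j` and `t` at once, and `t` is then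
moved back. -/
theorem performs_copy {i j t : ℕ} (hij : i ≠ j) (hit : i ≠ t) (hjt : j ≠ t) :
    Performs A RegRep (fun r => r t = 0) fun r => update r j (r j + r i) := by
  have h : Performs A RegRep (fun _ => True) fun r =>
      update (update (update r j (r j + r i)) t (r t + r i)) i 0 := by
    refine performs_loop i ((performs_regInc j).seq (performs_regInc t) fun _ h => h)
      (fun r _ h => ?_) fun r _ h => ⟨trivial, trivial, ?_, ?_⟩
    · ext s
      simp only [update_apply]
      grind
    · simp [hij, hit]
    · ext s
      simp only [update_apply]
      grind
  refine (h.seq (performs_move hit.symm) fun _ h => h).congr (fun _ _ => trivial) fun r hr => ?_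
  ext s
  simp only [update_apply]
  grind

theorem performs_clearRange (m t : ℕ) :
    Performs A RegRep (fun _ => True) fun r j => if m ≤ j ∧ j < m + t then 0 else r j := by
  induction t with
  | zero =>
    refine Performs.id.congr (fun _ h => h) fun r _ => ?_
    ext j
    simp
  | succ t ih =>
    refine (ih.seq (performs_clear (m + t)) fun _ h => h).congr (fun _ h => h) fun r _ => ?_
    ext j
    simp only [update_apply]
    grind

/-- For all registers `a` for the arguments, `o` for the value, and `m` for the beginning of the
working space, there is code that evaluates `f`, restoring all registers but `o`. -/
def RegComputable (A : Type) {n : ℕ} (f : List.Vector ℕ n → ℕ) : Prop :=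
  ∀ (a : Fin n → ℕ) (o m : ℕ), (∀ i, a i < m) → o < m → (∀ i, a i ≠ o) →
    Performs A RegRep (fun r => r o = 0 ∧ ∀ j, m ≤ j → r j = 0) fun r =>
      update r o (f (List.Vector.ofFn fun i => r (a i)))

namespace RegComputable

theorem zero : RegComputable A fun _ : List.Vector ℕ 0 => 0 := by
  intro a o m ha ho hao
  refine (Performs.id (P := fun _ => True)).congr (fun _ _ => trivial) fun r hr => ?_
  simp [← hr.1]

theorem get {n : ℕ} (i : Fin n) : RegComputable A fun v => v.get i := by
  intro a o m ha ho hao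
  have := ha i
  refine (performs_copy (hao i) (t := m) (by omega) (by omega)).congr
    (fun r hr => hr.2 m le_rfl) fun r hr => ?_
  simp [hr.1]

theorem succ : RegComputable A fun v : List.Vector ℕ 1 => v.head.succ := by
  intro a o m ha ho hao
  refine ((get (A := A) (0 : Fin 1) a o m ha ho hao).seq (performs_regInc o)
    fun _ _ => trivial).congr (fun r hr => hr) fun r hr => ?_
  simp

/-- Evaluate several functions, storing the values in consecutive registers. -/
theorem performs_range {n : ℕ} {g : ℕ → List.Vector ℕ n → ℕ} (hg : ∀ i, RegComputable A (g i))
    (a : Fin n → ℕ) (m : ℕ) (ha : ∀ i, a i < m) (t : ℕ) :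
    Performs A RegRep (fun r => ∀ j, m ≤ j → r j = 0) fun r j =>
      if m ≤ j ∧ j < m + t then g (j - m) (List.Vector.ofFn fun i => r (a i)) else r j := by
  induction t with
  | zero =>
    refine Performs.id.congr (fun _ h => h) fun r _ => ?_
    ext j
    simp
  | succ t ih =>
    refine (ih.seq (hg t a (m + t) (m + t + 1) (fun i => ?_) (by omega) fun i => ?_) ?_).congr
      (fun _ h => h) fun r hr => ?_
    · have := ha i; omega
    · have := ha i; omega
    · intro r hr
      refine ⟨?_, fun j hj => ?_⟩
      · simp [hr]
      · exact (if_neg (by omega)).trans (hr j (by omega))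
    · have h : ∀ i, ¬ (m ≤ a i ∧ a i < m + t) := fun i => by have := ha i; omega
      ext j
      simp only [update_apply, h, if_false]
      by_cases hj : j = m + t
      · subst hj; simp
      · by_cases hj' : m ≤ j ∧ j < m + t
        · rw [if_pos (by omega), if_neg hj, if_pos hj']
        · rw [if_neg (by omega), if_neg hj, if_neg hj']

theorem comp {k n : ℕ} {f : List.Vector ℕ n → ℕ} {g : Fin n → List.Vector ℕ k → ℕ}
    (hf : RegComputable A f) (hg : ∀ i, RegComputable A (g i)) :
    RegComputable A fun v => f (List.Vector.ofFn fun i => g i v) := by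
  rcases Nat.eq_zero_or_pos n with rfl | hn
  · intro a o m ha ho hao
    refine (hf Fin.elim0 o m (fun i => i.elim0) ho fun i => i.elim0).congr (fun _ h => h)
      fun r _ => ?_
    rfl
  -- `performs_range` wants a family indexed by all of `ℕ`. The periodic extension of `g` needs `0 <
  -- n`, hence the separate case above.
  have hg' : ∀ i, RegComputable A (g ⟨i % n, Nat.mod_lt _ hn⟩) := fun i => hg _
  intro a o m ha ho hao
  refine ((((performs_range hg' a m ha n).congr (fun r hr => hr.2) fun _ _ => rfl).seq
    (P := fun r => r o = 0 ∧ ∀ j, m ≤ j → r j = 0)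
    (hf (fun i => m + i) o (m + n) (fun i => by omega) (by omega) fun i => by omega) ?_).seq
    (performs_clearRange m n) fun _ _ => trivial).congr (fun _ h => h) fun r hr => ?_
  · intro r hr
    exact ⟨(if_neg (by omega)).trans hr.1, fun j hj => (if_neg (by omega)).trans (hr.2 j (by omega))⟩
  · ext j
    simp only [update_apply]
    by_cases hj : m ≤ j ∧ j < m + n
    · rw [if_neg (by omega), if_pos hj, hr.2 j hj.1]
    · rw [if_neg hj]
      by_cases hjo : j = o
      · simp [hjo, Nat.mod_eq_of_lt]
      · simp only [if_neg hjo, if_neg hj]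

/-- Register `m` counts the rounds left, `m + 1` is the recursion index, `o` holds the current
value, and `m + 2` receives the next one. The loop invariant is that `o` contains the value of the
recursion at the index. -/
theorem prec {n : ℕ} {f : List.Vector ℕ n → ℕ} {g : List.Vector ℕ (n + 2) → ℕ}
    (hf : RegComputable A f) (hg : RegComputable A g) :
    RegComputable A fun v : List.Vector ℕ (n + 1) =>
      v.head.rec (f v.tail) fun y IH => g (y ::ᵥ IH ::ᵥ v.tail) := by
  intro a o m ha ho hao
  have ha0 := ha 0
  have ho0 := hao 0
  let tl (r : ℕ → ℕ) : List.Vector ℕ n := List.Vector.ofFn fun i => r (a i.succ)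
  let val (r : ℕ → ℕ) (t : ℕ) : ℕ := t.rec (f (tl r)) fun y IH => g (y ::ᵥ IH ::ᵥ tl r)
  have htl {r r' : ℕ → ℕ} (h : ∀ j, j < m → j ≠ o → r j = r' j) : tl r = tl r' := by
    simp only [tl, h _ (ha _) (hao _)]
  have hval {r r' : ℕ → ℕ} (h : ∀ j, j < m → j ≠ o → r j = r' j) (t : ℕ) :
      val r t = val r' t := by
    simp only [val, htl h]
  have hbody : Performs A RegRep (fun r => ∀ j, m + 2 ≤ j → r j = 0) fun r =>
      update (update r o (g (r (m + 1) ::ᵥ r o ::ᵥ tl r))) (m + 1) (r (m + 1) + 1) := by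
    refine (((((hg (Fin.cons (m + 1) (Fin.cons o fun i => a i.succ)) (m + 2) (m + 3)
      ?_ (by omega) ?_).seq (performs_clear o) fun _ _ => trivial).seq
      (performs_move (i := m + 2) (j := o) (by omega)) fun _ _ => trivial).seq
      (performs_regInc (m + 1)) fun _ _ => trivial)).congr
      (fun r hr => ⟨hr _ le_rfl, fun j hj => hr j (by omega)⟩) fun r hr => ?_
    · refine Fin.cases (by simp) (Fin.cases (by simp; omega) fun i => ?_)
      have := ha i.succ
      simp; omega
    · refine Fin.cases (by simp) (Fin.cases (by simp; omega) fun i => ?_)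
      have := ha i.succ
      simp; omega
    · have hv : (List.Vector.ofFn fun i =>
          r ((Fin.cons (m + 1) (Fin.cons o fun i => a i.succ) : Fin (n + 2) → ℕ) i)) =
          r (m + 1) ::ᵥ r o ::ᵥ tl r := rfl
      have h2 := hr (m + 2) le_rfl
      rw [hv]
      ext j
      simp only [update_apply]
      grind
  have hloop : Performs A RegRep
      (fun r => (∀ j, m + 2 ≤ j → r j = 0) ∧ r o = val r (r (m + 1))) fun r =>
      update (update (update r o (val r (r (m + 1) + r m))) (m + 1) (r (m + 1) + r m)) m 0 := by
    refine performs_loop m hbody (fun r hr h => ?_) fun r hr h => ?_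
    · ext j
      simp only [update_apply]
      grind
    · set r₁ := update r m (r m - 1) with hr₁
      set r₂ := update (update r₁ o (g (r₁ (m + 1) ::ᵥ r₁ o ::ᵥ tl r₁))) (m + 1)
        (r₁ (m + 1) + 1) with hr₂
      have e₁ : tl r₁ = tl r := htl fun j hj _ => by simp [hr₁, hj.ne]
      have e₂ : ∀ t, val r₂ t = val r t := hval fun j hj hjo => by
        rw [hr₂, update_of_ne (by omega), update_of_ne hjo, hr₁, update_of_ne hj.ne]
      have eo : r₁ o = val r (r (m + 1)) := by rw [hr₁, update_of_ne ho.ne, hr.2]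
      have ey : r₁ (m + 1) = r (m + 1) := by simp [hr₁]
      have eo₂ : r₂ o = val r (r (m + 1) + 1) := by
        rw [hr₂, update_of_ne (by omega), update_self, ey, eo, e₁]
      have ey₂ : r₂ (m + 1) = r (m + 1) + 1 := by simp [hr₂, ey]
      have em₂ : r₂ m = r m - 1 := by
        rw [hr₂, update_of_ne (by omega), update_of_ne ho.ne', hr₁, update_self]
      refine ⟨fun j hj => ?_, ⟨fun j hj => ?_, ?_⟩, em₂, ?_⟩
      · rw [hr₁, update_of_ne (by omega), hr.1 j hj]
      · rw [hr₂, update_of_ne (by omega), update_of_ne (by omega), hr₁,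
          update_of_ne (by omega), hr.1 j hj]
      · rw [eo₂, e₂, ey₂]
      · have es : r (m + 1) + 1 + (r m - 1) = r (m + 1) + r m := by omega
        rw [e₂, ey₂, em₂, es]
        ext j
        simp only [hr₂, hr₁, update_apply]
        grind
  refine ((((hf (fun i => a i.succ) o m (fun i => ha _) ho fun i => hao _).seq
    (performs_copy (i := a 0) (j := m) (t := m + 1) (by omega) (by omega) (by omega)) ?_).seq
    hloop ?_).seq (performs_clear (m + 1)) fun _ _ => trivial).congr (fun _ h => h) fun r hr => ?_
  · intro r hr
    simp only [update_apply]
    rw [if_neg (by omega), hr.2 _ (by omega)]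
  · intro r hr
    have e : ∀ t, val _ t = val r t := hval (r := update (update r o (f (tl r))) m
        (update r o (f (tl r)) m + update r o (f (tl r)) (a 0))) fun j hj hjo => by
      rw [update_of_ne hj.ne, update_of_ne hjo]
    refine ⟨fun j hj => ?_, ?_⟩
    · rw [update_of_ne (by omega), update_of_ne (by omega), hr.2 j (by omega)]
    · refine Eq.trans ?_ (e _).symm
      rw [update_of_ne ho.ne, update_self, update_of_ne (by omega), update_of_ne (by omega),
        hr.2 _ (by omega)]
      rfl
  · have e : ∀ t, val _ t = val r t := hval (r := update (update r o (f (tl r))) m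
        (update r o (f (tl r)) m + update r o (f (tl r)) (a 0))) fun j hj hjo => by
      rw [update_of_ne hj.ne, update_of_ne hjo]
    have hm := hr.2 m le_rfl
    have hm1 := hr.2 (m + 1) (by omega)
    have hv : val r (r (a 0)) = (List.Vector.ofFn fun i => r (a i)).head.rec
        (f (List.Vector.ofFn fun i => r (a i)).tail) fun y IH =>
          g (y ::ᵥ IH ::ᵥ (List.Vector.ofFn fun i => r (a i)).tail) := by
      simp [val, tl]
    refine (congrArg (update r o) hv.symm).trans ?_
    simp only [show (List.Vector.ofFn fun i => r (a i.succ)) = tl r from rfl, e]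
    ext j
    simp only [update_apply]
    grind

end RegComputable

theorem regComputable_of_primrec {n : ℕ} {f : List.Vector ℕ n → ℕ} (hf : Nat.Primrec' f) :
    RegComputable A f := by
  induction hf with
  | zero => exact .zero
  | succ => exact .succ
  | get i => exact .get i
  | comp g _ _ hf hg => exact hf.comp hg
  | prec _ _ hf hg => exact hf.prec hg

end TCMI

/-! ### From primitive recursive transducers to online machines -/

namespace TCMI

variable {A : Type}

open Function

/-- Leave through the exit given by the content of a register, clearing it. -/
theorem computes_dispatch (i K : ℕ) :
    Computes A RegRep fun r (e : Fin K) r' => r i = e ∧ r' = update r i 0 := by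
  induction K with
  | zero =>
    exact ⟨Unit, inferInstance, (), fun _ => .halt, by simp, fun _ e => e.elim0⟩
  | succ K ih =>
    refine ((computes_regDec i).cond
      (ih.bind (T := fun e => _) fun e => Computes.pure e.succ) (Computes.pure 0)).mono ?_
    rintro r e _ ⟨h, rfl⟩
    induction e using Fin.cases with
    | zero =>
      have h : r i = 0 := h
      exact ⟨r, .inr ⟨.inl ⟨h, rfl, rfl⟩, rfl, by simp [← h]⟩⟩
    | succ e =>
      simp only [Fin.val_succ] at h
      exact ⟨_, .inl ⟨.inr ⟨by omega, rfl, rfl⟩, e, _, ⟨by simp [h], rfl⟩, rfl, by simp⟩⟩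

/-- A single number is represented by the register `0`, all other registers being empty. -/
def NatRep (k : Fin 2 → ℕ) (x : ℕ) : Prop :=
  RegRep k (update 0 0 x)

theorem performs_primrec {g : ℕ → ℕ} (hg : Primrec g) {i o m : ℕ} (hi : i < m) (ho : o < m)
    (hio : i ≠ o) :
    Performs A RegRep (fun r => r o = 0 ∧ ∀ j, m ≤ j → r j = 0) fun r =>
      update r o (g (r i)) := by
  have h := regComputable_of_primrec (A := A) (Nat.Primrec'.prim_iff₁.2 hg)
    (fun _ => i) o m (fun _ => hi) ho fun _ => hio
  exact h.congr (fun _ h => h) fun r _ => by simp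

/-- Replace a number by its image under a primitive recursive function, and leave through the
exit given by a second such function. -/
theorem computes_primrec {g h : ℕ → ℕ} (hg : Primrec g) (hh : Primrec h) (K : ℕ) :
    Computes A NatRep fun x (e : Fin K) y => y = g x ∧ h y = e := by
  refine Computes.lift ((((((performs_primrec hg (i := 0) (o := 1) (m := 2) (by omega) (by omega)
    (by omega)).seq (performs_clear 0) fun _ _ => trivial).seq
    (performs_move (i := 1) (j := 0) (by omega)) fun _ _ => trivial)).seq
    (performs_primrec hh (i := 0) (o := 1) (m := 2) (by omega) (by omega)
      (by omega)) ?_).andThen (computes_dispatch 1 K)) ?_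
  · intro r hr
    refine ⟨by simp, fun j hj => ?_⟩
    simp only [update_apply]
    grind
  · rintro x e _ ⟨rfl, he⟩ k hk
    refine ⟨_, hk, _, ⟨⟨by simp, fun j hj => ?_⟩, ?_, rfl⟩, fun k' hk' => ?_⟩
    · rw [update_of_ne (by omega)]; rfl
    · simpa using he
    · unfold NatRep
      convert hk' using 1
      ext j
      simp only [update_apply, Pi.zero_apply]
      grind

/-- Every primitive recursive transducer with finitely many output values is simulated by a two
counter machine that works online. -/
theorem exists_online_of_primrec [Finite A] {σ : Type} [Primcodable σ] (s₀ : σ)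
    {next : A → σ → σ} (hnext : ∀ a, Primrec (next a)) {out : σ → ℕ} (hout : Primrec out)
    {K : ℕ} (hK : ∀ s, out s < K) :
    ∃ (Q : Type) (_ : Finite Q) (M : TCMI A Q) (res : Q → ℕ), M.IsOnline ∧
      ∀ w : List A, ∃ q, M.HaltsIn w q ∧ res q = out (w.foldl (fun s a => next a s) s₀) := by
  let dec (x : ℕ) : σ := (Encodable.decode x).getD s₀
  have hdec : Primrec dec := Primrec.option_getD.comp Primrec.decode (Primrec.const s₀)
  have dec_encode (s : σ) : dec (Encodable.encode s) = s := by simp [dec]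
  -- Here `none` labels the initialization, which stores the code of `s₀`; it does not stand for the
  -- stop marker.
  let g (a : Option A) (x : ℕ) : ℕ := Encodable.encode (a.elim s₀ fun a => next a (dec x))
  have hg : ∀ a, Primrec (g a)
    | none => Primrec.const (Encodable.encode s₀)
    | some a => Primrec.encode.comp ((hnext a).comp hdec)
  choose S hS s code hr H using fun a =>
    computes_primrec (A := A) (hg a) (hout.comp hdec) K
  let Q : Type := Unit ⊕ Fin K ⊕ Fin K ⊕ Σ a, S a
  let wait (e : Fin K) : Q := .inr (.inl e)
  let final (e : Fin K) : Q := .inr (.inr (.inl e))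
  let run (a : Option A) (t : S a) : Q := .inr (.inr (.inr ⟨a, t⟩))
  let φ (a : Option A) : S a ⊕ Fin K → Q := Sum.elim (run a) wait
  let M : TCMI A Q :=
    { start := .inl ()
      -- The initial counter `0` represents no registers; `1`, the empty product, represents empty
      -- ones.
      code := Sum.elim (fun _ => .inc 0 (run none (s none)))
        (Sum.elim (fun e => .read fun a => a.elim (final e) fun a => run (some a) (s (some a)))
          (Sum.elim (fun _ => .halt) fun t => (code t.1 t.2).map (φ t.1))) }
  have hrun (a : Option A) (x : ℕ) (e : Fin K) (he : out (dec (g a x)) = e) (k : Fin 2 → ℕ)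
      (hk : NatRep k x) : ∃ k', NatRep k' (g a x) ∧
        ∀ l, M.Reaches ⟨run a (s a), k, l⟩ ⟨wait e, k', l⟩ := by
    obtain ⟨k', hk', h⟩ := H a x e (g a x) ⟨rfl, he⟩ k hk
    refine ⟨k', hk', fun l => (h l).map (φ a) ?_⟩
    rintro (t | t) ht
    · rfl
    · exact absurd rfl ht
  have hword (w : List A) : ∀ (st : σ) (k : Fin 2 → ℕ), NatRep k (Encodable.encode st) →
      ∃ k', M.Reaches ⟨wait ⟨out st, hK st⟩, k, w.map some ++ [none]⟩
        ⟨final ⟨out (w.foldl (fun s a => next a s) st), hK _⟩, k', []⟩ := by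
    induction w with
    | nil => exact fun st k hk => ⟨k, .single rfl⟩
    | cons a w ih =>
      intro st k hk
      have hga : g (some a) (Encodable.encode st) = Encodable.encode (next a st) := by
        simp [g, dec_encode]
      obtain ⟨k₁, hk₁, h₁⟩ := hrun (some a) _ ⟨out (next a st), hK _⟩
        (by rw [hga, dec_encode]) k hk
      obtain ⟨k₂, h₂⟩ := ih (next a st) k₁ (hga ▸ hk₁)
      exact ⟨k₂, .head rfl ((h₁ _).trans h₂)⟩
  refine ⟨Q, inferInstance, M,
    Sum.elim (fun _ => 0) (Sum.elim (fun e => e) (Sum.elim (fun e => e) fun _ => 0)), ?_, ?_⟩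
  · rintro (q | e | e | t) nx hq k c hc
    · exact absurd hq (by simp [M])
    · have hnx : nx none = final e := by
        have := Instr.read.inj hq
        rw [← this]; rfl
      rw [hnx] at hc
      rcases hc.cases_head with rfl | ⟨c', h, -⟩
      · rfl
      · exact absurd h (by simp [step, M, final])
    · exact absurd hq (by simp [M])
    · exact absurd hq (Instr.map_ne_read (hr _ _) _)
  · intro w
    have h0 : NatRep (update (fun _ => 0) 0 1) 0 := by
      refine ⟨by simp, by simp, fun i => ?_⟩
      simp [update_apply]
    obtain ⟨k₁, hk₁, h₁⟩ := hrun none 0 ⟨out s₀, hK s₀⟩ (by simp [g, dec_encode]) _ h0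
    obtain ⟨k₂, h₂⟩ := hword w s₀ k₁ hk₁
    exact ⟨_, ⟨rfl, k₂, .head rfl ((h₁ _).trans h₂)⟩, rfl⟩

end TCMI

/-! ### Best approximations -/

/-- If the exponents differed, one significand would be the other times a positive power of `d`,
hence at least `d ^ n`. -/
theorem digits_mul_zpow_inj {d n m m' : ℕ} {k k' : ℤ} (hd : 2 ≤ d) (hn : 1 ≤ n)
    (hm : d ^ (n - 1) ≤ m) (hm₁ : m < d ^ n) (hm' : d ^ (n - 1) ≤ m') (hm'₁ : m' < d ^ n)
    (h : (m : ℚ) * (d : ℚ) ^ k = m' * (d : ℚ) ^ k') : (m, k) = (m', k') := by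
  wlog hk : k ≤ k' generalizing m m' k k'
  · exact (this hm' hm'₁ hm hm₁ h.symm (by omega)).symm
  obtain ⟨j, rfl⟩ := Int.le.dest hk
  have hd0 : (d : ℚ) ≠ 0 := by positivity
  have h' : m = m' * d ^ j := by
    rw [zpow_add₀ hd0, zpow_natCast] at h
    have : (m : ℚ) = m' * d ^ j := by
      apply mul_right_cancel₀ (zpow_ne_zero k hd0)
      rw [h]; ring
    exact_mod_cast this
  rcases j with _ | j
  · simp at h'
    simp [h']
  · have : d ^ n ≤ m := by
      calc d ^ n = d ^ (n - 1) * d ^ 1 := by rw [← pow_add]; congr 1; omega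
        _ ≤ m' * d ^ (j + 1) :=
          Nat.mul_le_mul hm' (Nat.pow_le_pow_right (by omega) (by omega))
        _ = m := h'.symm
    omega

/-- Between `m` and `m + 1` there are no numbers with `n` digits if `m` has `n` digits. -/
theorem digits_mul_zpow_le_or_ge {d n m m' : ℕ} {k' : ℤ} (hd : 2 ≤ d) (hn : 1 ≤ n)
    (hm : d ^ (n - 1) ≤ m) (hm'₁ : m' < d ^ n) :
    (m' : ℚ) * (d : ℚ) ^ k' ≤ m ∨ (m : ℚ) + 1 ≤ m' * (d : ℚ) ^ k' := by
  -- With a nonnegative exponent the number is an integer; with a negative one it is at most `d ^ (n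
  -- - 1)`, hence at most `m`.
  rcases le_or_gt 0 k' with hk | hk
  · lift k' to ℕ using hk
    rw [zpow_natCast]
    rcases Nat.lt_or_ge m (m' * d ^ k') with h | h
    · right; exact_mod_cast h
    · left; exact_mod_cast h
  · left
    have hd1 : (1 : ℚ) ≤ d := by exact_mod_cast (by omega : 1 ≤ d)
    have hd0 : (d : ℚ) ≠ 0 := by positivity
    calc (m' : ℚ) * (d : ℚ) ^ k' ≤ (d : ℚ) ^ n * (d : ℚ) ^ (-1 : ℤ) := by
          refine mul_le_mul (by exact_mod_cast hm'₁.le) (zpow_le_zpow_right₀ hd1 (by omega))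
            (by positivity) (by positivity)
      _ = (d : ℚ) ^ (n - 1) := by
          rw [← zpow_natCast, ← zpow_natCast, ← zpow_add₀ hd0]
          congr 1; push_cast [hn]; ring
      _ ≤ m := by exact_mod_cast hm

theorem isBestApprox_lower {d n m : ℕ} {x : ℚ} (hd : 2 ≤ d) (hn : 1 ≤ n)
    (hm : d ^ (n - 1) ≤ m) (hm₁ : m < d ^ n) (hx : (m : ℚ) ≤ x)
    (h : 2 * x < 2 * m + 1 ∨ 2 * x = 2 * m + 1 ∧ Even m) : IsBestApprox d n x m 0 := by
  refine ⟨hm, hm₁, fun m' k' hm' hm'₁ hne => ?_⟩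
  set v := (m' : ℚ) * (d : ℚ) ^ k' with hv
  rw [zpow_zero, mul_one, abs_of_nonneg (by linarith)]
  rcases digits_mul_zpow_le_or_ge (k' := k') hd hn hm hm'₁ with hle | hge
  · have : v ≠ m := fun hvm => hne <| digits_mul_zpow_inj hd hn hm' hm'₁ hm hm₁
      (by rw [← hv, hvm]; simp)
    have : v < m := lt_of_le_of_ne hle this
    left
    rw [abs_of_nonneg (by linarith)]
    linarith
  · rw [← hv] at hge
    rw [abs_of_nonpos (by rcases h with h | h <;> linarith)]
    rcases h with h | ⟨h, he⟩
    · left; linarith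
    · rcases hge.lt_or_eq with hlt | heq
      · left; linarith
      · right; exact ⟨by linarith, .inl he⟩

/-- The pair `(m₁, k₁)` is kept general because `m + 1` may be `d ^ n`, which has one digit too many
and needs exponent `1`. -/
theorem isBestApprox_upper {d n m m₁ : ℕ} {k₁ : ℤ} {x : ℚ} (hd : 2 ≤ d) (hn : 1 ≤ n)
    (hm : d ^ (n - 1) ≤ m) (hm' : m < d ^ n) (hm₁ : d ^ (n - 1) ≤ m₁) (hm₁' : m₁ < d ^ n)
    (h₁ : (m₁ : ℚ) * (d : ℚ) ^ k₁ = m + 1) (hx : x < m + 1)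
    (h : 2 * (m : ℚ) + 1 < 2 * x ∨ 2 * x = 2 * m + 1 ∧ Odd m) : IsBestApprox d n x m₁ k₁ := by
  refine ⟨hm₁, hm₁', fun m' k' hm'' hm''₁ hne => ?_⟩
  set v := (m' : ℚ) * (d : ℚ) ^ k' with hv
  rw [h₁, abs_of_neg (a := x - (m + 1)) (by linarith)]
  rcases digits_mul_zpow_le_or_ge (k' := k') hd hn hm hm''₁ with hle | hge
  · rw [← hv] at hle
    rw [abs_of_nonneg (by rcases h with h | h <;> linarith)]
    rcases h with h | ⟨h, ho⟩
    · left; linarith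
    · rcases hle.lt_or_eq with hlt | heq
      · left; linarith
      -- The tying rival is `m` itself, odd and smaller, so the second tie clause applies whatever
      -- the parity of `m₁`.
      · right
        refine ⟨by linarith, .inr ⟨?_, by linarith⟩⟩
        have := digits_mul_zpow_inj (k' := 0) hd hn hm'' hm''₁ hm hm' (by rw [← hv, heq]; simp)
        exact (Prod.mk.inj this).1 ▸ ho
  · have : v ≠ m + 1 := fun hvm => hne <| digits_mul_zpow_inj hd hn hm'' hm''₁ hm₁ hm₁'
      (by rw [← hv, hvm, h₁])
    have : (m : ℚ) + 1 < v := lt_of_le_of_ne hge this.symm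
    left
    rw [abs_of_neg (by linarith)]
    linarith

/-- Scaling by `d ^ t` permutes the floating point numbers, keeps significands, and multiplies all
distances by the same factor. -/
theorem IsBestApprox.mul_zpow {d n m : ℕ} {x : ℚ} {k : ℤ} (hd : 2 ≤ d)
    (h : IsBestApprox d n x m k) (t : ℤ) : IsBestApprox d n (x * (d : ℚ) ^ t) m (k + t) := by
  have hd0 : (d : ℚ) ≠ 0 := by positivity
  have ht : 0 < (d : ℚ) ^ t := by positivity
  have key (j : ℤ) (a : ℕ) : |x * (d : ℚ) ^ t - a * (d : ℚ) ^ (j + t)| =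
      |x - a * (d : ℚ) ^ j| * (d : ℚ) ^ t := by
    rw [zpow_add₀ hd0, ← mul_assoc, ← sub_mul, abs_mul, abs_of_pos ht]
  refine ⟨h.1, h.2.1, fun m' k' hm' hm'₁ hne => ?_⟩
  obtain ⟨j, rfl⟩ : ∃ j, k' = j + t := ⟨k' - t, by ring⟩
  have := h.2.2 m' j hm' hm'₁ (by simpa using hne)
  rw [key, key, mul_lt_mul_iff_left₀ ht, mul_left_inj' ht.ne', zpow_add₀ hd0, zpow_add₀ hd0,
    ← mul_assoc, ← mul_assoc, mul_lt_mul_iff_left₀ ht]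
  exact this

theorem IsSignificand.mul_zpow {d n m : ℕ} {x : ℚ} (hd : 2 ≤ d)
    (h : IsSignificand d n x m) (t : ℤ) : IsSignificand d n (x * (d : ℚ) ^ t) m :=
  h.imp' (· + t) fun _ hk => hk.mul_zpow hd t

theorem IsSignificand.lt {d n m : ℕ} {x : ℚ} (h : IsSignificand d n x m) : m < d ^ n :=
  h.elim fun _ hk => hk.2.1

/-- The significand of the rounded value of `P / Q`, if the integral part has `n` digits. -/
def roundQuotient (d n P Q : ℕ) : ℕ :=
  if 2 * P < (2 * (P / Q) + 1) * Q ∨ 2 * P = (2 * (P / Q) + 1) * Q ∧ P / Q % 2 = 0 then P / Q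
  else if P / Q + 1 = d ^ n then d ^ (n - 1) else P / Q + 1

theorem isSignificand_roundQuotient {d n P Q : ℕ} (hd : 2 ≤ d) (hn : 1 ≤ n) (hQ : 0 < Q)
    (h₁ : d ^ (n - 1) ≤ P / Q) (h₂ : P / Q < d ^ n) :
    IsSignificand d n ((P : ℚ) / Q) (roundQuotient d n P Q) := by
  have hQ' : (0 : ℚ) < Q := by exact_mod_cast hQ
  have hle : ((P / Q : ℕ) : ℚ) ≤ P / Q := Nat.cast_div_le
  have hlt : (P : ℚ) / Q < (P / Q : ℕ) + 1 := by
    rw [div_lt_iff₀ hQ']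
    exact_mod_cast (Nat.div_lt_iff_lt_mul hQ).1 (Nat.lt_succ_self (P / Q))
  unfold roundQuotient
  generalize P / Q = m at *
  split_ifs with h h'
  · refine ⟨0, isBestApprox_lower hd hn h₁ h₂ hle (h.imp ?_ (And.imp ?_ ?_))⟩
    · intro h
      rw [← mul_div_assoc, div_lt_iff₀ hQ']
      exact_mod_cast h
    · intro h
      rw [← mul_div_assoc, div_eq_iff hQ'.ne']
      exact_mod_cast h
    · exact Nat.even_iff.2
  all_goals
    have hu : 2 * (m : ℚ) + 1 < 2 * (P / Q) ∨ 2 * ((P : ℚ) / Q) = 2 * m + 1 ∧ Odd m := by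
      push Not at h
      rw [← mul_div_assoc, lt_div_iff₀ hQ', div_eq_iff hQ'.ne', ← Nat.not_even_iff_odd,
        Nat.even_iff]
      rcases h.1.lt_or_eq with hl | he
      · left; exact_mod_cast hl
      · right; exact ⟨by exact_mod_cast he.symm, h.2 he.symm⟩
  · refine ⟨1, isBestApprox_upper hd hn h₁ h₂ le_rfl
      (Nat.pow_lt_pow_right (by omega) (by omega)) ?_ hlt hu⟩
    rw [zpow_one]
    have : d ^ (n - 1) * d = m + 1 := by rw [h', ← pow_succ]; congr 1; omega
    exact_mod_cast this
  · exact ⟨0, isBestApprox_upper hd hn h₁ h₂ (by omega) (by omega) (by simp) hlt hu⟩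

/-- The significand of the best `n`-digit approximation of `p / q` in radix `d`. -/
def significand (d n p q : ℕ) : ℕ :=
  roundQuotient d n (p * d ^ (n - 1 + q))
    (q * d ^ Nat.findGreatest (fun i => q * d ^ i * d ^ (n - 1) ≤ p * d ^ (n - 1 + q))
      (p * d ^ (n - 1 + q)))

/-- The factor `d ^ (n - 1 + q)` makes the quotient large enough, as `q ≤ d ^ q`. Dividing by the
largest admissible `d ^ i` then leaves exactly `n` digits in the integral part. -/
theorem isSignificand_significand {d n p q : ℕ} (hd : 2 ≤ d) (hn : 1 ≤ n) (hp : 0 < p)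
    (hq : 0 < q) : IsSignificand d n ((p : ℚ) / q) (significand d n p q) := by
  unfold significand
  set P := p * d ^ (n - 1 + q) with hP
  set i := Nat.findGreatest (fun i => q * d ^ i * d ^ (n - 1) ≤ P) P with hi
  have hd0 : 0 < d := by omega
  have h0 : q * d ^ 0 * d ^ (n - 1) ≤ P := by
    rw [hP, pow_add, pow_zero, mul_one, mul_comm (d ^ (n - 1)), ← mul_assoc]
    refine Nat.mul_le_mul_right _ ?_
    calc q ≤ d ^ q := (Nat.lt_pow_self (by omega)).le
      _ ≤ p * d ^ q := Nat.le_mul_of_pos_left _ hp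
  have h1 : q * d ^ i * d ^ (n - 1) ≤ P :=
    Nat.findGreatest_spec (P := fun i => q * d ^ i * d ^ (n - 1) ≤ P) (Nat.zero_le P) h0
  have h2 : P < q * d ^ i * d ^ n := by
    have e : q * d ^ (i + 1) * d ^ (n - 1) = q * d ^ i * d ^ n := by
      obtain ⟨n, rfl⟩ := Nat.exists_eq_add_of_le' hn
      simp only [Nat.add_sub_cancel]; ring
    rw [← e]
    -- The search bound `P` loses nothing: beyond it, `d ^ (i + 1)` alone exceeds `P`.
    by_cases hiP : i + 1 ≤ P
    · exact not_le.1 (Nat.findGreatest_is_greatest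
        (P := fun i => q * d ^ i * d ^ (n - 1) ≤ P) (Nat.lt_succ_self i) hiP)
    · calc P < i + 1 := not_le.1 hiP
        _ ≤ d ^ (i + 1) := (Nat.lt_pow_self (by omega)).le
        _ ≤ q * d ^ (i + 1) := Nat.le_mul_of_pos_left _ hq
        _ ≤ _ := Nat.le_mul_of_pos_right _ (by positivity)
  have hQ : 0 < q * d ^ i := by positivity
  have key := (isSignificand_roundQuotient (P := P) hd hn hQ
    ((Nat.le_div_iff_mul_le hQ).2 (by rwa [mul_comm]))
    ((Nat.div_lt_iff_lt_mul hQ).2 (by rwa [mul_comm (d ^ n)]))).mul_zpow hd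
      ((i : ℤ) - (n - 1 + q : ℕ))
  convert key using 1
  have hd' : (d : ℚ) ≠ 0 := by positivity
  have hq' : (q : ℚ) ≠ 0 := by positivity
  rw [zpow_sub₀ hd', zpow_natCast, zpow_natCast, hP]
  push_cast
  field_simp

/-! ### Primitive recursiveness of the significand -/

theorem Primrec.const_pow (d : ℕ) : Primrec fun x : ℕ => d ^ x := by
  refine (Primrec.nat_rec' (f := fun x : ℕ => x) (g := fun _ => 1)
    (h := fun _ (p : ℕ × ℕ) => p.2 * d) .id (.const 1)
    (Primrec.nat_mul.comp (Primrec.snd.comp .snd) (.const d)).to₂).of_eq fun x => ?_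
  induction x with
  | zero => rfl
  | succ x ih => rw [pow_succ, ← ih]

theorem primrec_roundQuotient (d n : ℕ) : Primrec₂ (roundQuotient d n) := by
  have hP : Primrec fun x : ℕ × ℕ => x.1 := .fst
  have hQ : Primrec fun x : ℕ × ℕ => x.2 := .snd
  have hm : Primrec fun x : ℕ × ℕ => x.1 / x.2 := Primrec.nat_div.comp hP hQ
  have h2P : Primrec fun x : ℕ × ℕ => 2 * x.1 := Primrec.nat_mul.comp (.const 2) hP
  have hmid : Primrec fun x : ℕ × ℕ => (2 * (x.1 / x.2) + 1) * x.2 :=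
    Primrec.nat_mul.comp (Primrec.succ.comp (Primrec.nat_mul.comp (.const 2) hm)) hQ
  have hs : Primrec fun x : ℕ × ℕ => x.1 / x.2 + 1 := Primrec.succ.comp hm
  exact Primrec.ite ((Primrec.nat_lt.comp h2P hmid).or ((Primrec.eq.comp h2P hmid).and
    (Primrec.eq.comp (Primrec.nat_mod.comp hm (.const 2)) (.const 0)))) hm
    (Primrec.ite (Primrec.eq.comp hs (.const (d ^ n))) (.const _) hs)

theorem primrec_significand (d n : ℕ) : Primrec₂ (significand d n) := by
  have hP : Primrec fun x : ℕ × ℕ => x.1 * d ^ (n - 1 + x.2) :=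
    Primrec.nat_mul.comp .fst ((Primrec.const_pow d).comp (Primrec.nat_add.comp (.const _) .snd))
  refine (primrec_roundQuotient d n).comp hP (Primrec.nat_mul.comp .snd
    ((Primrec.const_pow d).comp (Primrec.nat_findGreatest hP ?_)))
  exact Primrec.nat_le.comp (Primrec.nat_mul.comp (Primrec.nat_mul.comp (Primrec.snd.comp .fst)
    ((Primrec.const_pow d).comp .snd)) (.const _)) (hP.comp .fst)

/-- The significand of `f * D ^ e`, where `e` is the integer with absolute value `a` that is
negative if `neg` is true. -/
def scaledSignificand (d D n : ℕ) (neg : Bool) (f a : ℕ) : ℕ :=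
  bif neg then significand d n f (D ^ a) else significand d n (f * D ^ a) 1

/-- Reduction modulo `d ^ n` is harmless for `f > 0`. It bounds the output in all states of the
transducer, including those with factor `0`. -/
theorem isSignificand_scaledSignificand {d D n f : ℕ} (hd : 2 ≤ d) (hD : 2 ≤ D) (hn : 1 ≤ n)
    (hf : 0 < f) (neg : Bool) (a : ℕ) :
    IsSignificand d n ((f : ℚ) * (D : ℚ) ^ signed neg a)
      (scaledSignificand d D n neg f a % d ^ n) := by
  have hDa : 0 < D ^ a := by positivity
  have h : IsSignificand d n ((f : ℚ) * (D : ℚ) ^ signed neg a)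
      (scaledSignificand d D n neg f a) := by
    cases neg with
    | true =>
      convert isSignificand_significand hd hn hf hDa using 1
      · simp [signed, div_eq_mul_inv]
      · rfl
    | false =>
      convert isSignificand_significand hd hn (Nat.mul_pos hf hDa) one_pos using 1
      · simp [signed]
      · rfl
  rwa [Nat.mod_eq_of_lt h.lt]

theorem primrec_scaledSignificand (d D n : ℕ) {σ : Type} [Primcodable σ] {neg : σ → Bool}
    {f a : σ → ℕ} (hneg : Primrec neg) (hf : Primrec f) (ha : Primrec a) :
    Primrec fun s => scaledSignificand d D n (neg s) (f s) (a s) % d ^ n := by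
  have hp := (Primrec.const_pow D).comp ha
  exact Primrec.nat_mod.comp (Primrec.cond hneg ((primrec_significand d n).comp hf hp)
    ((primrec_significand d n).comp (Primrec.nat_mul.comp hf hp) (.const 1))) (.const _)

/-! ### Reading digits -/

/-- Take one more digit into account. The state consists of the value of the digits read so far
and of the weight of the next digit (used only if the least significant digit comes first). -/
def DigitOrder.push (b : ℕ) : DigitOrder → ℕ → ℕ × ℕ → ℕ × ℕ
  | .leastFirst, a, s => (s.1 + a * s.2, s.2 * b)
  | .mostFirst, a, s => (s.1 * b + a, s.2)

theorem DigitOrder.primrec_push (b : ℕ) (o : DigitOrder) (a : ℕ) : Primrec (o.push b a) := by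
  cases o with
  | leastFirst =>
    exact Primrec.pair (Primrec.nat_add.comp .fst (Primrec.nat_mul.comp (.const a) .snd))
      (Primrec.nat_mul.comp .snd (.const b))
  | mostFirst =>
    exact Primrec.pair (Primrec.nat_add.comp (Primrec.nat_mul.comp .fst (.const b)) (.const a))
      .snd

theorem DigitOrder.foldl_push {b : ℕ} (o : DigitOrder) (z : List (Fin b)) :
    (z.foldl (fun s (a : Fin b) => o.push b a s) (0, 1)).1 = o.value z := by
  cases o with
  | leastFirst =>
    -- The induction needs an arbitrary initial value and weight.
    have key : ∀ v p : ℕ, (z.foldl (fun s (a : Fin b) => DigitOrder.leastFirst.push b a s) (v, p)).1 =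
        v + p * Nat.ofDigits b (z.map Fin.val) := by
      induction z with
      | nil => simp
      | cons a z ih =>
        intro v p
        simp only [List.foldl_cons, List.map_cons, Nat.ofDigits_cons]
        refine (ih (v + a * p) (p * b)).trans ?_
        ring
    simpa [DigitOrder.value] using key 0 1
  | mostFirst =>
    have key : ∀ v p : ℕ, (z.foldl (fun s (a : Fin b) => DigitOrder.mostFirst.push b a s) (v, p)).1 =
        Nat.ofDigits b (z.map Fin.val).reverse + b ^ z.length * v := by
      induction z with
      | nil => simp
      | cons a z ih =>
        intro v p
        simp only [List.foldl_cons, List.map_cons, List.reverse_cons, Nat.ofDigits_append,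
          List.length_cons]
        refine (ih (v * b + a) p).trans ?_
        simp only [Nat.ofDigits_singleton, List.length_reverse, List.length_map]; ring
    simpa [DigitOrder.value] using key 0 1

instance {b : ℕ} : Finite (NumeralSymbol b) :=
  Finite.of_surjective
    (Sum.elim NumeralSymbol.digit fun t : Bool => if t then .sep else .minus)
    (by
      rintro (a | _ | _)
      · exact ⟨.inl a, rfl⟩
      · exact ⟨.inr true, rfl⟩
      · exact ⟨.inr false, rfl⟩)

/-- Take one more symbol of a numeral into account. The state consists of two flags, set by the
separator and by the minus sign, and of the states for the factor and for the exponent. -/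
def NumeralSymbol.push {b : ℕ} (o o' : DigitOrder) :
    NumeralSymbol b → (Bool × Bool) × (ℕ × ℕ) × (ℕ × ℕ) → (Bool × Bool) × (ℕ × ℕ) × (ℕ × ℕ)
  | .digit a, s =>
    bif s.1.1 then (s.1, s.2.1, o'.push b a s.2.2) else (s.1, o.push b a s.2.1, s.2.2)
  | .sep, s => ((true, s.1.2), s.2)
  | .minus, s => ((s.1.1, true), s.2)

theorem NumeralSymbol.primrec_push {b : ℕ} (o o' : DigitOrder) (c : NumeralSymbol b) :
    Primrec (c.push o o') := by
  have h11 : Primrec fun s : (Bool × Bool) × (ℕ × ℕ) × (ℕ × ℕ) => s.1.1 := Primrec.fst.comp .fst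
  have h12 : Primrec fun s : (Bool × Bool) × (ℕ × ℕ) × (ℕ × ℕ) => s.1.2 := Primrec.snd.comp .fst
  have h21 : Primrec fun s : (Bool × Bool) × (ℕ × ℕ) × (ℕ × ℕ) => s.2.1 := Primrec.fst.comp .snd
  have h22 : Primrec fun s : (Bool × Bool) × (ℕ × ℕ) × (ℕ × ℕ) => s.2.2 := Primrec.snd.comp .snd
  cases c with
  | digit a =>
    exact Primrec.cond h11 (Primrec.pair .fst (Primrec.pair h21 ((o'.primrec_push b a).comp h22)))
      (Primrec.pair .fst (Primrec.pair ((o.primrec_push b a).comp h21) h22))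
  | sep => exact Primrec.pair (Primrec.pair (.const true) h12) .snd
  | minus => exact Primrec.pair (Primrec.pair h11 (.const true)) .snd

theorem foldl_push_numeral {b : ℕ} (o o' : DigitOrder) (u : List (Fin b)) (neg : Bool)
    (v : List (Fin b)) :
    (numeral u neg v).foldl (fun s c => c.push o o' s) ((false, false), (0, 1), (0, 1)) =
      ((true, neg), u.foldl (fun s (a : Fin b) => o.push b a s) (0, 1),
        v.foldl (fun s (a : Fin b) => o'.push b a s) (0, 1)) := by
  have hu : ∀ s t : ℕ × ℕ, ∀ g : Bool,
      u.foldl (fun s a => (NumeralSymbol.digit a).push o o' s) ((false, g), s, t) =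
        ((false, g), u.foldl (fun s (a : Fin b) => o.push b a s) s, t) := by
    induction u with
    | nil => exact fun _ _ _ => rfl
    | cons a u ih => exact fun s t g => ih (o.push b a s) t g
  have hv : ∀ s t : ℕ × ℕ, ∀ g : Bool,
      v.foldl (fun s a => (NumeralSymbol.digit a).push o o' s) ((true, g), s, t) =
        ((true, g), s, v.foldl (fun s (a : Fin b) => o'.push b a s) t) := by
    induction v with
    | nil => exact fun _ _ _ => rfl
    | cons a v ih => exact fun s t g => ih s (o'.push b a t) g
  unfold numeral
  rw [List.foldl_append, List.foldl_append, List.foldl_append, List.foldl_map,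
    List.foldl_map, hu]
  cases neg
  · exact hv _ _ _
  · exact hv _ _ _

/-! ### The two transducers -/

theorem mainTheorem6 (d D b n : ℕ) (hd : 2 ≤ d) (hD : 2 ≤ D) (hb : 2 ≤ b) (hn : 1 ≤ n) :
    -- the factor and the exponent are both input
    (∀ o o' : DigitOrder,
      ∃ (Q : Type) (_ : Finite Q) (M : TCMI (NumeralSymbol b) Q) (out : Q → ℕ),
        M.IsOnline ∧
        ∀ (u : List (Fin b)) (neg : Bool) (v : List (Fin b)), 0 < o.value u →
          ∃ q : Q, M.HaltsIn (numeral u neg v) q ∧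
            IsSignificand d n ((o.value u : ℚ) * (D : ℚ) ^ signed neg (o'.value v)) (out q)) ∧
    -- the factor and the sign of the exponent are fixed, only digits are input
    (∀ (f : ℕ) (neg : Bool) (o : DigitOrder), 0 < f →
      ∃ (Q : Type) (_ : Finite Q) (M : TCMI (Fin b) Q) (out : Q → ℕ),
        M.IsOnline ∧
        ∀ v : List (Fin b),
          ∃ q : Q, M.HaltsIn v q ∧
            IsSignificand d n ((f : ℚ) * (D : ℚ) ^ signed neg (o.value v)) (out q)) := by
  have hpos : 0 < d ^ n := by positivity
  constructor
  · intro o o'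
    -- The output depends only on the minus flag and the two values; the separator flag and the
    -- weights merely guide the reading.
    obtain ⟨Q, hQ, M, out, hM, H⟩ := TCMI.exists_online_of_primrec
      ((false, false), (0, 1), (0, 1)) (NumeralSymbol.primrec_push (b := b) o o')
      (primrec_scaledSignificand d D n (Primrec.snd.comp .fst)
        (Primrec.fst.comp (Primrec.fst.comp .snd)) (Primrec.fst.comp (Primrec.snd.comp .snd)))
      fun _ => Nat.mod_lt _ hpos
    refine ⟨Q, hQ, M, out, hM, fun u neg v hu => ?_⟩
    obtain ⟨q, hq, hout⟩ := H (numeral u neg v)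
    refine ⟨q, hq, ?_⟩
    rw [hout, foldl_push_numeral, o.foldl_push, o'.foldl_push]
    exact isSignificand_scaledSignificand hd hD hn hu neg _
  · intro f neg o hf
    obtain ⟨Q, hQ, M, out, hM, H⟩ := TCMI.exists_online_of_primrec
      (0, 1) (fun a : Fin b => o.primrec_push b a)
      (primrec_scaledSignificand d D n (.const neg) (.const f) .fst)
      fun _ => Nat.mod_lt _ hpos
    refine ⟨Q, hQ, M, out, hM, fun v => ?_⟩
    obtain ⟨q, hq, hout⟩ := H v
    refine ⟨q, hq, ?_⟩
    rw [hout, o.foldl_push]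
    exact isSignificand_scaledSignificand hd hD hn hf neg _
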